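/- Let $G$ be a finite abelian group. An S-ring over $G$ is a subring $\mathcal A\subseteq\mathbb ZG$ that is the $\mathbb Z$-span of the sums $\sum_{x\in X}x$, where $X$ runs over the classes (basic sets) of a partition $\mathcal S(\mathcal A)$ of $G$ that contains $\{1\}$ and is closed under $X\mapsto X^{-1}$. Its automorphism group $\mathrm{Aut}(\mathcal A)\le \mathrm{Sym}(G)$ consists of the permutations leaving every relation $\{(g,xg): g\in G,\ x\in X\}$, $X\in\mathcal S(\mathcal A)$, fixed; $\mathcal A$ is schurian if these relations are the orbits on $G\times G$ of some permutation group on $G$. Two permutation groups on $V$ are 2-equivalent ($\approx_2$) if they have the same orbits on $V\times V$. An $\mathcal A$-subgroup is a subgroup that is a union of basic sets. For $\mathcal A$-subgroups $U,L$, let $\mathcal A_U$ and $\mathcal A_{G/L}$ be the S-rings over $U$ and over $G/L$ whose basic sets are, respectively, the basic sets of $\mathcal A$ contained in $U$ and the images in $G/L$ of the basic sets of $\mathcal A$. $H_{\mathrm{right}}$ denotes the group of right translations of a group $H$, and $\Gamma^U$, $\Gamma^{G/L}$, $\Gamma^{U/L}$ denote the groups of permutations induced on $U$, $G/L$, $U/L$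 by (the appropriate setwise stabilizer in) a permutation group $\Gamma$. Let $L\le U\le G$. Call a pair of groups $\Delta_U\le\mathrm{Sym}(U)$, $\Delta_0\le\mathrm{Sym}(G/L)$ compatible if $U_{\mathrm{right}}\le\Delta_U$, $(G/L)_{\mathrm{right}}\le\Delta_0$, the partition of $U$ into $L$-cosets is $\Delta_U$-invariant, the partition of $G/L$ into $U/L$-cosets is $\Delta_0$-invariant, and $(\Delta_U)^{U/L}=(\Delta_0)^{U/L}$. For a compatible pair the canonical generalized wreath product $\Delta_U\wr_{U/L}\Delta_0$ is the group of all $\gamma\in\mathrm{Sym}(G)$ that leave the partitions of $G$ into $L$-cosets and into $U$-cosets invariant, induce on $G/L$ an element of $\Delta_0$, and map each $U$-coset $X$ onto its image $X'$ by a composition of a right translation $X\to U$, an element of $\Delta_U$, and a right translation $U\to X'$. **Theorem.** Let $\mathcal A$ be an S-ring over $G$ that is the generalized wreath product of $\mathcal A_U$ and $\mathcal A_{G/L}$ over $U/L$, i.e. $L\le U$ are $\mathcal A$-subgroups of $G$ and every basic set contained in $G\setminus U$ is a union of $L$-cosets. Then: 1. the groups $\mathrm{Aut}(\mathcal A)^U$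 and $\mathrm{Aut}(\mathcal A)^{G/L}$ form a compatible pair, and $\mathrm{Aut}(\mathcal A)=\mathrm{Aut}(\mathcal A)^U\wr_{U/L}\mathrm{Aut}(\mathcal A)^{G/L}$; 2. $\mathcal A$ is schurian if and only if $\mathcal A_U$ and $\mathcal A_{G/L}$ are schurian and there is a compatible pair $\Delta_U,\Delta_0$ such that $\Delta_U\approx_2\mathrm{Aut}(\mathcal A_U)$ and $\Delta_0\approx_2\mathrm{Aut}(\mathcal A_{G/L})$; 3. for every compatible pair with $\Delta_U\approx_2\mathrm{Aut}(\mathcal A_U)$ and $\Delta_0\approx_2\mathrm{Aut}(\mathcal A_{G/L})$ one has $\Delta_U\le\mathrm{Aut}(\mathcal A_U)$, $\Delta_0\le\mathrm{Aut}(\mathcal A_{G/L})$ and $\mathrm{Aut}(\mathcal A)\approx_2\Delta_U\wr_{U/L}\Delta_0$. -/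

import Mathlib

open scoped Pointwise

noncomputable section

namespace SchurRing

/-! ### Permutation groups -/

section Permutations

variable {V W : Type*}

/-- The set of orbits of a permutation group `Γ ≤ Sym(V)` acting coordinatewise on `V × V`. -/
def orb2 (Γ : Subgroup (Equiv.Perm V)) : Set (Set (V × V)) :=
  {R | ∃ p : V × V, R = {q | ∃ γ ∈ Γ, q = (γ p.1, γ p.2)}}

/-- Two permutation groups on `V` are 2-equivalent if they have the same orbits on `V × V`. -/
def TwoEquiv (Γ Γ' : Subgroup (Equiv.Perm V)) : Prop :=
  orb2 Γ = orb2 Γ'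

/-- For `q : V → W` (meant to be onto), the group of permutations of `W` induced by
those elements of `Γ ≤ Sym(V)` that permute the fibres of `q`. -/
def inducedOn (Γ : Subgroup (Equiv.Perm V)) (q : V → W) : Subgroup (Equiv.Perm W) where
  carrier := {τ | ∃ γ ∈ Γ, ∀ v, τ (q v) = q (γ v)}
  one_mem' := ⟨1, Γ.one_mem, fun _ => rfl⟩
  mul_mem' := by
    rintro a b ⟨γ, hγ, h⟩ ⟨δ, hδ, h'⟩
    exact ⟨γ * δ, Γ.mul_mem hγ hδ, fun v => by simp [h, h']⟩
  inv_mem' := by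
    rintro a ⟨γ, hγ, h⟩
    refine ⟨γ⁻¹, Γ.inv_mem hγ, fun v => ?_⟩
    rw [Equiv.Perm.inv_eq_iff_eq, h]
    simp

variable {G : Type*} [Group G]

/-- The group `Γ^U` of permutations of the subgroup `U` of `G` induced by the setwise stabilizer
of `U` in `Γ ≤ Sym(G)`. -/
def inducedSub (Γ : Subgroup (Equiv.Perm G)) (U : Subgroup G) : Subgroup (Equiv.Perm U) where
  carrier := {τ | ∃ γ ∈ Γ, ∀ u : U, (τ u : G) = γ u}
  one_mem' := ⟨1, Γ.one_mem, fun _ => rfl⟩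
  mul_mem' := by
    rintro a b ⟨γ, hγ, h⟩ ⟨δ, hδ, h'⟩
    exact ⟨γ * δ, Γ.mul_mem hγ hδ, fun v => by simp [h, h']⟩
  inv_mem' := by
    rintro a ⟨γ, hγ, h⟩
    refine ⟨γ⁻¹, Γ.inv_mem hγ, fun v => ?_⟩
    rw [Equiv.Perm.eq_inv_iff_eq, ← h]
    simp

variable (G) in
/-- The group of all permutations `x ↦ x * g` of `G`. -/
def rightRegular : Subgroup (Equiv.Perm G) where
  carrier := {σ | ∃ g : G, ∀ x, σ x = x * g}
  one_mem' := ⟨1, fun x => by simp⟩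
  mul_mem' := by
    rintro a b ⟨g, hg⟩ ⟨h, hh⟩
    exact ⟨h * g, fun x => by simp [hg, hh, mul_assoc]⟩
  inv_mem' := by
    rintro a ⟨g, hg⟩
    exact ⟨g⁻¹, fun x => by rw [Equiv.Perm.inv_eq_iff_eq, hg]; simp⟩

/-- The permutation `σ` of `G` leaves fixed the equivalence relation on `G` whose classes are the
left cosets of the subgroup `H`. -/
def PreservesCosets (H : Subgroup G) (σ : Equiv.Perm G) : Prop :=
  ∀ x y : G, (σ x)⁻¹ * σ y ∈ H ↔ x⁻¹ * y ∈ H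

end Permutations

/-! ### Schur rings -/

section SRings

/-- The element `∑ x ∈ X, x` of the group ring `ℤG`. -/
def setSum {G : Type*} [Finite G] (X : Set G) : MonoidAlgebra ℤ G :=
  ∑ x ∈ X.toFinite.toFinset, MonoidAlgebra.single x 1

/-- A Schur ring over a finite group `G`: a subring of `ℤG` which is the `ℤ`-span of the elements
`∑ x ∈ X, x`, where `X` runs over the classes of a partition of `G` that contains `{1}` and is
closed under inversion. (These elements are automatically linearly independent, and the partition
is determined by the subring.) -/
structure SRing (G : Type*) [Group G] [Finite G] where
  /-- the underlying subring of the group ring -/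
  toSubring : Subring (MonoidAlgebra ℤ G)
  /-- the basic sets -/
  basicSets : Set (Set G)
  isPartition : Setoid.IsPartition basicSets
  singleton_one_mem : {1} ∈ basicSets
  inv_mem : ∀ X ∈ basicSets, X⁻¹ ∈ basicSets
  mem_iff_mem_span : ∀ ξ, ξ ∈ toSubring ↔ ξ ∈ Submodule.span ℤ (setSum '' basicSets)

open Classical in
theorem coeff_setSum {G : Type*} [Finite G] (X : Set G) (g : G) :
    (setSum X).coeff g = if g ∈ X then 1 else 0 := by
  simp [setSum, MonoidAlgebra.coeff_sum, Finsupp.single_apply]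

theorem mem_span_iff {G : Type*} [Finite G] {P : Set (Set G)} (hP : Setoid.IsPartition P)
    (ξ : MonoidAlgebra ℤ G) :
    ξ ∈ Submodule.span ℤ (setSum '' P) ↔
      ∀ X ∈ P, ∀ x ∈ X, ∀ y ∈ X, ξ.coeff x = ξ.coeff y := by
  classical
  constructor
  · intro h X hX x hx y hy
    induction h using Submodule.span_induction with
    | mem z hz =>
      obtain ⟨Y, hY, rfl⟩ := hz
      rw [coeff_setSum, coeff_setSum]
      have : x ∈ Y ↔ y ∈ Y := by
        constructor
        · intro h
          rwa [(hP.2 x).unique ⟨hY, h⟩ ⟨hX, hx⟩]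
        · intro h
          rwa [(hP.2 y).unique ⟨hY, h⟩ ⟨hX, hy⟩]
      simp [this]
    | zero => simp
    | add a b _ _ ha hb => simp [ha, hb]
    | smul c a _ ha => simp [ha]
  · intro h
    have key : ξ = ∑ X ∈ P.toFinite.toFinset,
        (if hX : X.Nonempty then ξ.coeff hX.some else 0) • setSum X := by
      ext g
      obtain ⟨Y, ⟨hY, hgY⟩, huniq⟩ := hP.2 g
      rw [MonoidAlgebra.coeff_sum, Finsupp.finsetSum_apply, Finset.sum_eq_single Y]
      · have hne : Y.Nonempty := ⟨g, hgY⟩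
        simp only [hne, dif_pos, MonoidAlgebra.coeff_smul, Finsupp.smul_apply, coeff_setSum, hgY,
          if_true, smul_eq_mul, mul_one]
        exact h Y hY _ hgY _ hne.some_mem
      · intro X hX hXY
        have : g ∉ X := fun hg => hXY (huniq X ⟨by simpa using hX, hg⟩)
        rw [MonoidAlgebra.coeff_smul, Finsupp.smul_apply, coeff_setSum, if_neg this, smul_zero]
      · intro hY'
        exact absurd hY (by simpa using hY')
    rw [key]
    refine Submodule.sum_mem _ fun X hX => Submodule.smul_mem _ _ (Submodule.subset_span ?_)
    exact ⟨X, by simpa using hX, rfl⟩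

namespace SRing

section Basic

variable {G : Type*} [Group G] [Finite G] (A : SRing G)

theorem mem_iff (ξ : MonoidAlgebra ℤ G) :
    ξ ∈ A.toSubring ↔ ∀ X ∈ A.basicSets, ∀ x ∈ X, ∀ y ∈ X, ξ.coeff x = ξ.coeff y := by
  rw [A.mem_iff_mem_span, mem_span_iff A.isPartition]

theorem setSum_mem {X : Set G} (hX : X ∈ A.basicSets) : setSum X ∈ A.toSubring :=
  (A.mem_iff_mem_span _).2 (Submodule.subset_span ⟨X, hX, rfl⟩)

/-- `H` is an `A`-subgroup of `G`: a subgroup that is a union of basic sets of `A`. -/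
def IsASubgroup (H : Subgroup G) : Prop :=
  ∃ T ⊆ A.basicSets, ⋃₀ T = (H : Set G)

theorem eq_of_mem {X Y : Set G} (hX : X ∈ A.basicSets) (hY : Y ∈ A.basicSets) {g : G}
    (h : g ∈ X) (h' : g ∈ Y) : X = Y :=
  (A.isPartition.2 g).unique ⟨hX, h⟩ ⟨hY, h'⟩

variable {A} in
theorem IsASubgroup.mem_of_mem {H : Subgroup G} (hH : A.IsASubgroup H) {X : Set G}
    (hX : X ∈ A.basicSets) {x y : G} (hx : x ∈ X) (hy : y ∈ X) (h : x ∈ H) : y ∈ H := by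
  obtain ⟨T, hT, hTH⟩ := hH
  have h1 : x ∈ ⋃₀ T := by rw [hTH]; exact h
  obtain ⟨Y, hY, hxY⟩ := h1
  have : X = Y := A.eq_of_mem hX (hT hY) hx hxY
  have h2 : y ∈ ⋃₀ T := ⟨Y, hY, this ▸ hy⟩
  rw [hTH] at h2
  exact h2

variable {A} in
theorem IsASubgroup.setSum_mem {H : Subgroup G} (hH : A.IsASubgroup H) :
    setSum (H : Set G) ∈ A.toSubring := by
  classical
  rw [A.mem_iff]
  intro X hX x hx y hy
  have : x ∈ H ↔ y ∈ H := ⟨hH.mem_of_mem hX hx hy, hH.mem_of_mem hX hy hx⟩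
  simp [coeff_setSum, this]

/-- The basic relation `{(g, xg) : g ∈ G, x ∈ X}` of the Cayley scheme of an S-ring that
corresponds to the basic set `X`. -/
def cayleyRel (X : Set G) : Set (G × G) :=
  {p | ∃ g : G, ∃ x ∈ X, p = (g, x * g)}

/-- The automorphism group of an S-ring: the group of all permutations of `G` that leave every
basic relation of the Cayley scheme fixed. -/
def aut : Subgroup (Equiv.Perm G) where
  carrier := {σ | ∀ X ∈ A.basicSets, Prod.map σ σ '' cayleyRel X = cayleyRel X}
  one_mem' := by
    intro X _
    simp
  mul_mem' := by
    intro a b ha hb X hX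
    have : Prod.map (a * b) (a * b) = Prod.map a a ∘ Prod.map b b := rfl
    rw [this, Set.image_comp, hb X hX, ha X hX]
  inv_mem' := by
    intro a ha X hX
    conv_lhs => rw [← ha X hX]
    rw [← Set.image_comp, Prod.map_comp_map]
    simp

/-- An S-ring is schurian if its Cayley scheme is the scheme of 2-orbits of some permutation
group. -/
def IsSchurian : Prop :=
  ∃ Γ : Subgroup (Equiv.Perm G), cayleyRel '' A.basicSets = orb2 Γ

theorem image_preimage_eq_of_isASubgroup {U : Subgroup G} (hU : A.IsASubgroup U) {X : Set G}
    (hX : X ∈ A.basicSets) {x : G} (hx : x ∈ X) (hxU : x ∈ U) :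
    (Subtype.val '' (Subtype.val ⁻¹' X : Set U) : Set G) = X := by
  apply Set.image_preimage_eq_of_subset
  intro y hy
  exact ⟨⟨y, hU.mem_of_mem hX hx hy hxU⟩, rfl⟩

theorem isPartition_restrict {U : Subgroup G} (hU : A.IsASubgroup U) :
    Setoid.IsPartition {Y : Set U | Subtype.val '' Y ∈ A.basicSets} := by
  constructor
  · intro h
    apply A.isPartition.1
    simpa using h
  · intro u
    obtain ⟨X, ⟨hX, hu⟩, -⟩ := A.isPartition.2 (u : G)
    refine ⟨Subtype.val ⁻¹' X, ⟨?_, hu⟩, ?_⟩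
    · change Subtype.val '' _ ∈ A.basicSets
      rwa [A.image_preimage_eq_of_isASubgroup hU hX hu u.2]
    · rintro Y ⟨hY, huY⟩
      have := A.eq_of_mem hY hX (Set.mem_image_of_mem _ huY) hu
      rw [← this, Set.preimage_image_eq _ Subtype.val_injective]

/-- The S-ring `A_U` over an `A`-subgroup `U`; its basic sets are the basic sets of `A` that are
contained in `U`. -/
def restrict (U : Subgroup G) (hU : A.IsASubgroup U) : SRing U where
  toSubring := A.toSubring.comap (MonoidAlgebra.mapDomainRingHom ℤ U.subtype)
  basicSets := {Y | Subtype.val '' Y ∈ A.basicSets}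
  isPartition := A.isPartition_restrict hU
  singleton_one_mem := by
    have := A.singleton_one_mem
    simpa using this
  inv_mem := by
    intro Y hY
    have h := A.inv_mem _ hY
    have : (Subtype.val '' Y⁻¹ : Set G) = (Subtype.val '' Y)⁻¹ := by
      ext g
      constructor
      · rintro ⟨u, hu, rfl⟩
        exact ⟨u⁻¹, hu, rfl⟩
      · rintro ⟨u, hu, hg⟩
        exact ⟨u⁻¹, by simpa using hu, by simp [hg]⟩
    change Subtype.val '' Y⁻¹ ∈ A.basicSets
    rwa [this]
  mem_iff_mem_span := by
    intro ξ
    rw [mem_span_iff (A.isPartition_restrict hU), Subring.mem_comap, A.mem_iff]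
    have hin : ∀ u : U, (MonoidAlgebra.mapDomainRingHom ℤ U.subtype ξ).coeff (u : G)
        = ξ.coeff u := by
      intro u
      exact Finsupp.mapDomain_apply (Subtype.val_injective) _ u
    have hout : ∀ g : G, g ∉ U →
        (MonoidAlgebra.mapDomainRingHom ℤ U.subtype ξ).coeff g = 0 := by
      intro g hg
      exact Finsupp.mapDomain_of_notMem_range _ _ (by simpa using hg)
    constructor
    · intro h Y hY x hx y hy
      rw [← hin, ← hin]
      exact h _ hY _ (Set.mem_image_of_mem _ hx) _ (Set.mem_image_of_mem _ hy)
    · intro h X hX x hx y hy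
      by_cases hxU : x ∈ U
      · have hyU := hU.mem_of_mem hX hx hy hxU
        have := h (Subtype.val ⁻¹' X)
          (by
            change Subtype.val '' _ ∈ A.basicSets
            rwa [A.image_preimage_eq_of_isASubgroup hU hX hx hxU])
          ⟨x, hxU⟩ hx ⟨y, hyU⟩ hy
        rw [← hin, ← hin] at this
        exact this
      · have hyU : y ∉ U := fun h' => hxU (hU.mem_of_mem hX hy hx h')
        rw [hout x hxU, hout y hyU]

end Basic

section Quotient

variable {G : Type*} [CommGroup G] [Finite G] (A : SRing G) (L : Subgroup G)

theorem coeff_mul_eq_sum {H : Type*} [Group H] [Fintype H] (a b : MonoidAlgebra ℤ H) (g : H) :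
    (a * b).coeff g = ∑ h, a.coeff h * b.coeff (h⁻¹ * g) := by
  classical
  rw [MonoidAlgebra.coeff_mul_antidiag a b g (Finset.univ.image fun h => (h, h⁻¹ * g)),
    Finset.sum_image]
  · intro x _ y _ hxy
    exact congrArg Prod.fst hxy
  · rintro ⟨x, y⟩
    simp only [Finset.mem_image, Finset.mem_univ, true_and, Prod.mk.injEq]
    constructor
    · rintro ⟨h, rfl, rfl⟩
      simp
    · rintro rfl
      exact ⟨x, rfl, by simp⟩

/-- The element of `ℤG` whose coefficients are those of an element of `ℤ(G/L)`, pulled back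
along the natural epimorphism. -/
def pullback : MonoidAlgebra ℤ (G ⧸ L) →+ MonoidAlgebra ℤ G where
  toFun η := MonoidAlgebra.ofCoeff (Finsupp.ofSupportFinite (fun g : G => η.coeff (g : G ⧸ L))
    (Set.toFinite _))
  map_zero' := by ext; simp [Finsupp.ofSupportFinite]
  map_add' a b := by ext; simp [Finsupp.ofSupportFinite]; rfl

theorem coeff_pullback (η : MonoidAlgebra ℤ (G ⧸ L)) (g : G) :
    (pullback L η).coeff g = η.coeff (g : G ⧸ L) := rfl

theorem pullback_mul (a b : MonoidAlgebra ℤ (G ⧸ L)) :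
    pullback L a * pullback L b = (Nat.card L : ℤ) • pullback L (a * b) := by
  classical
  have := Fintype.ofFinite G
  have := Fintype.ofFinite (G ⧸ L)
  ext g
  rw [MonoidAlgebra.coeff_smul, Finsupp.smul_apply, coeff_pullback, coeff_mul_eq_sum,
    coeff_mul_eq_sum]
  simp only [coeff_pullback, QuotientGroup.mk_mul, QuotientGroup.mk_inv]
  rw [Finset.sum_comp (fun q : G ⧸ L => a.coeff q * b.coeff (q⁻¹ * (g : G ⧸ L)))
    (fun h : G => (h : G ⧸ L)), Finset.image_univ_of_surjective QuotientGroup.mk_surjective,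
    Finset.smul_sum]
  refine Finset.sum_congr rfl fun q _ => ?_
  have h := QuotientGroup.card_preimage_mk L {q}
  rw [Nat.card_unique (α := ({q} : Set (G ⧸ L))), mul_one] at h
  rw [← h, natCast_zsmul, Nat.card_eq_fintype_card, ← Set.toFinset_card]
  congr 2
  ext
  simp

theorem pullback_one : pullback L 1 = setSum (L : Set G) := by
  classical
  ext g
  rw [coeff_pullback, coeff_setSum, MonoidAlgebra.one_def, MonoidAlgebra.coeff_single,
    Finsupp.single_apply]
  simp [eq_comm (a := (1 : G ⧸ L))]

variable {L} in
theorem image_mk_subset (hL : A.IsASubgroup L) {X Y : Set G} (hX : X ∈ A.basicSets)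
    (hY : Y ∈ A.basicSets) {x y : G} (hx : x ∈ X) (hy : y ∈ Y)
    (hxy : (x : G ⧸ L) = (y : G ⧸ L)) :
    ((↑) '' Y : Set (G ⧸ L)) ⊆ (↑) '' X := by
  classical
  have := Fintype.ofFinite G
  have hco : ∀ g, (setSum (L : Set G) * setSum X).coeff g ≠ 0 ↔
      ∃ l ∈ L, l⁻¹ * g ∈ X := by
    intro g
    rw [coeff_mul_eq_sum]
    simp only [coeff_setSum]
    rw [Ne, Finset.sum_eq_zero_iff_of_nonneg]
    · simp [and_comm]
    · intro i _
      split_ifs <;> simp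
  have hm := (A.mem_iff _).1 (A.toSubring.mul_mem hL.setSum_mem (A.setSum_mem hX)) Y hY
  have h1 : ∃ l ∈ L, l⁻¹ * y ∈ X := by
    refine ⟨x⁻¹ * y, QuotientGroup.eq.1 hxy, ?_⟩
    simpa using hx
  rintro _ ⟨z, hz, rfl⟩
  have h2 := (hco y).2 h1
  rw [hm y hy z hz, hco] at h2
  obtain ⟨l, hl, hlz⟩ := h2
  refine ⟨_, hlz, ?_⟩
  rw [QuotientGroup.eq]
  simpa using hl

variable {L} in
theorem isPartition_quotient (hL : A.IsASubgroup L) :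
    Setoid.IsPartition ((fun X : Set G => ((↑) '' X : Set (G ⧸ L))) '' A.basicSets) := by
  constructor
  · rintro ⟨X, hX, h⟩
    apply A.isPartition.1
    rwa [← Set.image_eq_empty.1 h]
  · intro q
    obtain ⟨g, rfl⟩ := QuotientGroup.mk_surjective q
    obtain ⟨X, ⟨hX, hg⟩, -⟩ := A.isPartition.2 g
    refine ⟨_, ⟨⟨X, hX, rfl⟩, ⟨g, hg, rfl⟩⟩, ?_⟩
    rintro _ ⟨⟨Y, hY, rfl⟩, ⟨y, hy, hyg⟩⟩
    exact subset_antisymm (A.image_mk_subset hL hX hY hg hy hyg.symm)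
      (A.image_mk_subset hL hY hX hy hg hyg)

/-- The S-ring `A_{G/L}` over the quotient of `G` by an `A`-subgroup `L`; its basic sets are the
images of the basic sets of `A`. -/
def quotient (hL : A.IsASubgroup L) : SRing (G ⧸ L) where
  toSubring :=
    { carrier := {η | pullback L η ∈ A.toSubring}
      mul_mem' := by
        intro a b ha hb
        have h := A.toSubring.mul_mem ha hb
        rw [pullback_mul, A.mem_iff] at h
        refine (A.mem_iff _).2 fun X hX x hx y hy => ?_
        have h' := h X hX x hx y hy
        rw [MonoidAlgebra.coeff_smul, Finsupp.smul_apply, Finsupp.smul_apply] at h'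
        have hc : (Nat.card L : ℤ) ≠ 0 := by exact_mod_cast Nat.card_pos.ne'
        exact mul_left_cancel₀ hc h'
      one_mem' := by
        change pullback L 1 ∈ A.toSubring
        rw [pullback_one]
        exact hL.setSum_mem
      add_mem' := by
        intro a b ha hb
        change pullback L (a + b) ∈ A.toSubring
        rw [map_add]
        exact A.toSubring.add_mem ha hb
      zero_mem' := by
        change pullback L 0 ∈ A.toSubring
        rw [map_zero]
        exact A.toSubring.zero_mem
      neg_mem' := by
        intro a ha
        change pullback L (-a) ∈ A.toSubring
        rw [map_neg]
        exact A.toSubring.neg_mem ha }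
  basicSets := (fun X : Set G => ((↑) '' X : Set (G ⧸ L))) '' A.basicSets
  isPartition := A.isPartition_quotient hL
  singleton_one_mem := ⟨{1}, A.singleton_one_mem, by simp⟩
  inv_mem := by
    rintro _ ⟨X, hX, rfl⟩
    refine ⟨X⁻¹, A.inv_mem X hX, ?_⟩
    exact Set.image_inv (QuotientGroup.mk' L) X
  mem_iff_mem_span := by
    intro η
    rw [mem_span_iff (A.isPartition_quotient hL)]
    change pullback L η ∈ A.toSubring ↔ _
    rw [A.mem_iff]
    constructor
    · rintro h _ ⟨X, hX, rfl⟩ _ ⟨x, hx, rfl⟩ _ ⟨y, hy, rfl⟩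
      exact h X hX x hx y hy
    · intro h X hX x hx y hy
      exact h _ ⟨X, hX, rfl⟩ _ ⟨x, hx, rfl⟩ _ ⟨y, hy, rfl⟩

/-- The S-ring `A` over `G` is the generalized wreath product of `A_U` and `A_{G/L}`: the groups
`L ≤ U` are `A`-subgroups, and every basic set of `A` outside `U` is a union of `L`-cosets. -/
structure IsGenWreath (U L : Subgroup G) : Prop where
  le : L ≤ U
  isASubgroup_U : A.IsASubgroup U
  isASubgroup_L : A.IsASubgroup L
  mul_eq : ∀ X ∈ A.basicSets, X ⊆ (U : Set G)ᶜ → (L : Set G) * X = X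

end Quotient

end SRing

end SRings

/-! ### The canonical generalized wreath product of permutation groups -/

section Wreath

variable {G : Type*} [CommGroup G]

/-- The conditions on `Δ_U ≤ Sym(U)` and `Δ_0 ≤ Sym(G/L)` under which their canonical generalized
wreath product is formed: `Δ_U` and `Δ_0` contain the right regular groups, the section `U/L` is
invariant under both of them, and they induce the same permutation group on `U/L`, which is
realized as the subgroup `U.map (mk' L)` of `G/L`. -/
structure IsCompatible (U L : Subgroup G) (ΔU : Subgroup (Equiv.Perm U))
    (Δ0 : Subgroup (Equiv.Perm (G ⧸ L))) : Prop where
  rightRegular_le_U : rightRegular U ≤ ΔU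
  rightRegular_le_0 : rightRegular (G ⧸ L) ≤ Δ0
  invariant_U : ∀ δ ∈ ΔU, PreservesCosets (L.subgroupOf U) δ
  invariant_0 : ∀ δ ∈ Δ0, PreservesCosets (U.map (QuotientGroup.mk' L)) δ
  induced_eq : inducedOn ΔU ((QuotientGroup.mk' L).subgroupMap U) =
    inducedSub Δ0 (U.map (QuotientGroup.mk' L))

/-- The restriction of `γ` to `X` is an element of the set
`Δ_{X,X'} = (G_right)^{X,U} Δ_U (G_right)^{U,X'}` of bijections `X → X'`: it is the composition of a
right translation `X → U`, an element of `Δ_U`, and a right translation `U → X'`. -/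
def RestrictsToDelta {U : Subgroup G} (ΔU : Subgroup (Equiv.Perm U)) (X X' : Set G)
    (γ : Equiv.Perm G) : Prop :=
  ∃ a b : G, ∃ δ ∈ ΔU, (fun x => x * a) '' X = U ∧ (fun x => x * b) '' (U : Set G) = X' ∧
    ∀ x ∈ X, ∃ hx : x * a ∈ U, γ x = δ ⟨x * a, hx⟩ * b

theorem PreservesCosets.image_smul {U : Subgroup G} {γ : Equiv.Perm G}
    (h : PreservesCosets U γ) (c : G) : γ '' (c • (U : Set G)) = γ c • (U : Set G) := by
  ext y
  constructor
  · rintro ⟨x, hx, rfl⟩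
    rw [mem_leftCoset_iff] at hx ⊢
    exact (h c x).2 hx
  · intro hy
    refine ⟨γ⁻¹ y, ?_, by simp⟩
    rw [mem_leftCoset_iff] at hy ⊢
    refine (h c _).1 ?_
    simpa using hy

theorem PreservesCosets.inv {H : Subgroup G} {γ : Equiv.Perm G}
    (h : PreservesCosets H γ) : PreservesCosets H γ⁻¹ := by
  intro x y
  rw [← h]
  simp

theorem PreservesCosets.mul {H : Subgroup G} {γ γ' : Equiv.Perm G}
    (h : PreservesCosets H γ) (h' : PreservesCosets H γ') : PreservesCosets H (γ * γ') := by
  intro x y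
  exact (h _ _).trans (h' x y)

/-- The canonical generalized wreath product `Δ_U ≀_{U/L} Δ_0`: the group of all permutations `γ`
of `G` that leave fixed the partitions of `G` into the cosets of `L` and into the cosets of `U`,
induce on `G/L` an element of `Δ_0`, and whose restriction to each coset `X` of `U` belongs to
`Δ_{X,X'}`, where `X'` is the image of `X`. -/
def canonicalGenWreath {U L : Subgroup G} {ΔU : Subgroup (Equiv.Perm U)}
    {Δ0 : Subgroup (Equiv.Perm (G ⧸ L))} (h : IsCompatible U L ΔU Δ0) :
    Subgroup (Equiv.Perm G) where
  carrier := {γ | PreservesCosets L γ ∧ PreservesCosets U γ ∧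
    (∃ δ ∈ Δ0, ∀ g : G, δ (g : G ⧸ L) = (γ g : G ⧸ L)) ∧
    ∀ c : G, RestrictsToDelta ΔU (c • (U : Set G)) (γ '' (c • (U : Set G))) γ}
  one_mem' := by
    refine ⟨fun _ _ => Iff.rfl, fun _ _ => Iff.rfl, ⟨1, Δ0.one_mem, fun _ => rfl⟩, fun c => ?_⟩
    refine ⟨c⁻¹, c, 1, ΔU.one_mem, ?_, ?_, ?_⟩
    · ext x
      simp [Set.mem_smul_set_iff_inv_smul_mem, mul_comm]
    · ext x
      simp [Set.mem_smul_set_iff_inv_smul_mem, mul_comm]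
    · intro x hx
      rw [mem_leftCoset_iff, mul_comm] at hx
      exact ⟨hx, by simp⟩
  mul_mem' := by
    rintro γ γ' ⟨hL, hU, ⟨δ0, hδ0, h0⟩, hX⟩ ⟨hL', hU', ⟨δ0', hδ0', h0'⟩, hX'⟩
    refine ⟨hL.mul hL', hU.mul hU', ⟨δ0 * δ0', Δ0.mul_mem hδ0 hδ0', fun g => ?_⟩, fun c => ?_⟩
    · simp [h0, h0']
    · obtain ⟨a', b', δ', hδ', ha', hb', h1'⟩ := hX' c
      obtain ⟨a, b, δ, hδ, ha, hb, h1⟩ := hX (γ' c)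
      rw [hU'.image_smul] at hb'
      have hba : b' * a ∈ U := by
        have : b' ∈ γ' c • (U : Set G) := by
          rw [← hb']
          exact ⟨1, U.one_mem, by simp⟩
        have h2 : b' * a ∈ (fun x => x * a) '' (γ' c • (U : Set G)) := ⟨b', this, rfl⟩
        rwa [ha] at h2
      let ρ : Equiv.Perm U := Equiv.mulRight ⟨b' * a, hba⟩
      have hρ : ρ ∈ ΔU := h.rightRegular_le_U ⟨⟨b' * a, hba⟩, fun x => rfl⟩
      refine ⟨a', b, δ * ρ * δ', ΔU.mul_mem (ΔU.mul_mem hδ hρ) hδ', ha', ?_, ?_⟩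
      · rw [Equiv.Perm.coe_mul, Set.image_comp, hU'.image_smul]
        exact hb
      · intro x hx
        obtain ⟨hxa, h2⟩ := h1' x hx
        have hx' : γ' x ∈ γ' c • (U : Set G) := by
          rw [← hU'.image_smul]
          exact ⟨x, hx, rfl⟩
        obtain ⟨hya, h3⟩ := h1 _ hx'
        refine ⟨hxa, ?_⟩
        rw [Equiv.Perm.mul_apply, h3]
        have h4 : (⟨γ' x * a, hya⟩ : U) = ρ (δ' ⟨x * a', hxa⟩) := by
          ext
          simp [ρ, h2, mul_assoc]
        rw [h4]
        rfl
  inv_mem' := by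
    rintro γ ⟨hL, hU, ⟨δ0, hδ0, h0⟩, hX⟩
    refine ⟨hL.inv, hU.inv, ⟨δ0⁻¹, Δ0.inv_mem hδ0, fun g => ?_⟩, fun c => ?_⟩
    · rw [Equiv.Perm.inv_eq_iff_eq, h0]
      simp
    · obtain ⟨a, b, δ, hδ, ha, hb, h1⟩ := hX (γ⁻¹ c)
      have him : γ '' (γ⁻¹ c • (U : Set G)) = c • (U : Set G) := by
        rw [hU.image_smul]
        simp
      rw [him] at hb
      refine ⟨b⁻¹, a⁻¹, δ⁻¹, ΔU.inv_mem hδ, ?_, ?_, ?_⟩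
      · rw [← hb, ← Set.image_comp]
        convert Set.image_id _
        ext
        simp
      · rw [hU.inv.image_smul, ← ha, ← Set.image_comp]
        have : ((fun x => x * a⁻¹) ∘ fun x => x * a) = id := by
          ext
          simp
        rw [this, Set.image_id, ha]
      · intro x hx
        rw [← him] at hx
        obtain ⟨y, hy, rfl⟩ := hx
        obtain ⟨hya, h2⟩ := h1 y hy
        have h3 : γ y * b⁻¹ = δ ⟨y * a, hya⟩ := by rw [h2]; simp
        refine ⟨by rw [h3]; exact (δ _).2, ?_⟩
        have h4 : (⟨γ y * b⁻¹, by rw [h3]; exact (δ _).2⟩ : U) = δ ⟨y * a, hya⟩ := by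
          ext
          exact h3
        rw [h4]
        simp

end Wreath

end SchurRing

end

/-! A pair `(g, h)` either lies inside one `U`-coset or meets two. In the first case its basic
relation is governed by `A_U` after translation to `U`. In the second the basic set absorbs `L`, so
the relation is the full preimage of a basic relation on `G/L`. Hence the wreath product of any
compatible pair inside `Aut(A_U)` and `Aut(A_{G/L})` consists of automorphisms
(`canonicalGenWreath_le_aut`). Conversely, automorphisms respect cosets of `A`-subgroups, and right
translations bring their restrictions to `U`-cosets back to `U`; this gives the formula for
`Aut(A)`.

The remaining task is to show that the wreath product is large. Fix `δ0` in `Δ0`. On each `U`-coset,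
`δ0` followed and preceded by translations acts on `U/L` as an element of the group common to `ΔU`
and `Δ0`, so it lifts to that coset through `ΔU`. Lifts on different cosets can be chosen
independently and always glue (`IsCompatible.exists_mem_of_isLocalLift`). So any element of `ΔU` can
be realized on one coset (`IsCompatible.exists_mem_extending`), and images of points in distinct
`U`-cosets can be prescribed within their `L`-cosets (`IsCompatible.exists_mem_lifting`). These two
facts settle the two kinds of pairs, both for 2-equivalence and for transitivity on basic relations,
which is how schurity is expressed (`isSchurian_iff`). -/

namespace SchurRing

/-! ### 2-equivalence, and restriction to a coset by means of translations. -/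

section Permutations

variable {V : Type*} {Γ Γ' : Subgroup (Equiv.Perm V)}

theorem TwoEquiv.exists_apply_eq (h : TwoEquiv Γ Γ') {γ : Equiv.Perm V} (hγ : γ ∈ Γ) (x y : V) :
    ∃ γ' ∈ Γ', γ' x = γ x ∧ γ' y = γ y := by
  have h1 : {q | ∃ γ ∈ Γ, q = (γ x, γ y)} ∈ orb2 Γ := ⟨(x, y), rfl⟩
  have h0 : (x, y) ∈ {q | ∃ γ ∈ Γ, q = (γ x, γ y)} := ⟨1, Γ.one_mem, rfl⟩
  have h2 : (γ x, γ y) ∈ {q | ∃ γ ∈ Γ, q = (γ x, γ y)} := ⟨γ, hγ, rfl⟩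
  rw [h] at h1
  obtain ⟨p, hp⟩ := h1
  rw [hp] at h0 h2
  obtain ⟨α, hα, h0⟩ := h0
  obtain ⟨β, hβ, h2⟩ := h2
  simp only [Prod.mk.injEq] at h0 h2
  -- The base point `p` of the common orbit need not be `(x, y)`, so the path from `(x, y)` to its
  -- image under `γ` runs through `p`.
  refine ⟨β * α⁻¹, Γ'.mul_mem hβ (Γ'.inv_mem hα), ?_, ?_⟩
  · rw [h2.1, h0.1]; simp
  · rw [h2.2, h0.2]; simp

theorem twoEquiv_of_le (hle : Γ' ≤ Γ)
    (h : ∀ γ ∈ Γ, ∀ x y, ∃ γ' ∈ Γ', γ' x = γ x ∧ γ' y = γ y) : TwoEquiv Γ Γ' := by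
  have key : ∀ p : V × V, {q | ∃ γ ∈ Γ, q = (γ p.1, γ p.2)} =
      {q | ∃ γ ∈ Γ', q = (γ p.1, γ p.2)} := by
    rintro ⟨x, y⟩
    ext q
    constructor
    · rintro ⟨γ, hγ, rfl⟩
      obtain ⟨γ', hγ', hx, hy⟩ := h γ hγ x y
      exact ⟨γ', hγ', by rw [hx, hy]⟩
    · rintro ⟨γ, hγ, rfl⟩
      exact ⟨γ, hle hγ, rfl⟩
  simp only [TwoEquiv, orb2, key]

variable {G : Type*}

theorem PreservesCosets.apply_mem_iff [Group G] {H : Subgroup G} {σ : Equiv.Perm G}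
    (hσ : PreservesCosets H σ) {a : G} (ha : a ∈ H) (hσa : σ a ∈ H) (x : G) :
    σ x ∈ H ↔ x ∈ H := by
  rw [← H.mul_mem_cancel_left (H.inv_mem hσa), hσ a x, H.mul_mem_cancel_left (H.inv_mem ha)]

theorem mulRight_mem_of_rightRegular_le [Group G] {Γ : Subgroup (Equiv.Perm G)}
    (hΓ : rightRegular G ≤ Γ) (a : G) : Equiv.mulRight a ∈ Γ :=
  hΓ ⟨a, fun _ => rfl⟩

/-- Translations in `Γ` turn the action of `γ` from the coset of `c` to that of `y` into an action
on `H` itself; `y` may be any point of the image coset. -/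
theorem exists_mem_inducedSub [CommGroup G] {Γ : Subgroup (Equiv.Perm G)}
    (hΓ : rightRegular G ≤ Γ) {H : Subgroup G} (hH : ∀ γ ∈ Γ, PreservesCosets H γ)
    {γ : Equiv.Perm G} (hγ : γ ∈ Γ) {c y : G} (hy : γ c * y⁻¹ ∈ H) :
    ∃ τ ∈ inducedSub Γ H, ∀ u : H, (τ u : G) * y = γ (u * c) := by
  have hσ : Equiv.mulRight y⁻¹ * γ * Equiv.mulRight c ∈ Γ :=
    Γ.mul_mem (Γ.mul_mem (mulRight_mem_of_rightRegular_le hΓ _) hγ)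
      (mulRight_mem_of_rightRegular_le hΓ _)
  have hs := (hH _ hσ).apply_mem_iff H.one_mem (by simpa using hy)
  refine ⟨Equiv.Perm.subtypePerm _ hs, ⟨_, hσ, fun u => rfl⟩, fun u => ?_⟩
  simp

end Permutations

/-! ### Automorphisms of S-rings, and schurity as transitivity on basic relations. -/

namespace SRing

theorem mem_cayleyRel {G : Type*} [Group G] {X : Set G} {g h : G} : (g, h) ∈ cayleyRel X ↔ h * g⁻¹ ∈ X := by
  constructor
  · rintro ⟨k, x, hx, he⟩
    obtain ⟨rfl, rfl⟩ := Prod.mk.inj he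
    simpa using hx
  · intro hx
    exact ⟨g, _, hx, by simp⟩

section Group

variable {G : Type*} [Group G] [Finite G] (A : SRing G)

theorem exists_mem_basicSets (g : G) : ∃ X ∈ A.basicSets, g ∈ X :=
  (A.isPartition.2 g).exists

variable {A} in
theorem apply_mul_inv_mem {σ : Equiv.Perm G} (hσ : σ ∈ A.aut) {X : Set G}
    (hX : X ∈ A.basicSets) {g h : G} (hgh : h * g⁻¹ ∈ X) : σ h * (σ g)⁻¹ ∈ X := by
  rw [← mem_cayleyRel] at hgh ⊢
  rw [← hσ X hX]
  exact ⟨(g, h), hgh, rfl⟩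

/-- One inclusion suffices because the basic relations partition `G × G`: the preimage of a pair
lies in some basic relation, which must be the one containing the pair. -/
theorem mem_aut_of_forall {σ : Equiv.Perm G}
    (h : ∀ X ∈ A.basicSets, ∀ g h : G, h * g⁻¹ ∈ X → σ h * (σ g)⁻¹ ∈ X) : σ ∈ A.aut := by
  intro X hX
  ext ⟨g, k⟩
  constructor
  · rintro ⟨⟨g', k'⟩, hm, he⟩
    obtain ⟨rfl, rfl⟩ := Prod.mk.inj he
    exact mem_cayleyRel.2 (h X hX _ _ (mem_cayleyRel.1 hm))
  · intro hm
    refine ⟨(σ⁻¹ g, σ⁻¹ k), ?_, by simp⟩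
    obtain ⟨Y, hY, hgk⟩ := A.exists_mem_basicSets (σ⁻¹ k * (σ⁻¹ g)⁻¹)
    have h1 := h Y hY _ _ hgk
    simp only [Equiv.Perm.inv_def, Equiv.apply_symm_apply] at h1
    rw [A.eq_of_mem hX hY (mem_cayleyRel.1 hm) h1]
    exact mem_cayleyRel.2 hgk

theorem rightRegular_le_aut : rightRegular G ≤ A.aut := by
  rintro σ ⟨a, ha⟩
  refine A.mem_aut_of_forall fun X _ g h hgh => ?_
  rw [ha, ha]
  simpa using hgh

/-- `Γ` acts transitively on every basic relation of the Cayley scheme of `A`. -/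
def IsTransitiveOnRel (Γ : Subgroup (Equiv.Perm G)) : Prop :=
  ∀ X ∈ A.basicSets, ∀ g h g' h' : G, h * g⁻¹ ∈ X → h' * g'⁻¹ ∈ X →
    ∃ γ ∈ Γ, γ g = g' ∧ γ h = h'

variable {A} in
theorem IsTransitiveOnRel.mono {Γ Γ' : Subgroup (Equiv.Perm G)} (h : A.IsTransitiveOnRel Γ)
    (hle : Γ ≤ Γ') : A.IsTransitiveOnRel Γ' := by
  intro X hX g k g' k' h1 h2
  obtain ⟨γ, hγ, hg⟩ := h X hX g k g' k' h1 h2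
  exact ⟨γ, hle hγ, hg⟩

variable {A} in
theorem IsTransitiveOnRel.cayleyRel_image_eq_orb2 {Γ : Subgroup (Equiv.Perm G)}
    (h : A.IsTransitiveOnRel Γ) (hle : Γ ≤ A.aut) : cayleyRel '' A.basicSets = orb2 Γ := by
  have key : ∀ X ∈ A.basicSets, ∀ g k : G, k * g⁻¹ ∈ X →
      cayleyRel X = {q | ∃ γ ∈ Γ, q = (γ g, γ k)} := by
    intro X hX g k hgk
    ext ⟨g', k'⟩
    rw [mem_cayleyRel]
    constructor
    · intro h'
      obtain ⟨γ, hγ, rfl, rfl⟩ := h X hX g k g' k' hgk h'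
      exact ⟨γ, hγ, rfl⟩
    · rintro ⟨γ, hγ, he⟩
      obtain ⟨rfl, rfl⟩ := Prod.mk.inj he
      exact apply_mul_inv_mem (hle hγ) hX hgk
  ext R
  constructor
  · rintro ⟨X, hX, rfl⟩
    have hne : X.Nonempty := Set.nonempty_iff_ne_empty.2 fun h0 => A.isPartition.1 (h0 ▸ hX)
    obtain ⟨x, hx⟩ := hne
    exact ⟨(1, x), key X hX 1 x (by simpa using hx)⟩
  · rintro ⟨⟨g, k⟩, rfl⟩
    obtain ⟨X, hX, hgk⟩ := A.exists_mem_basicSets (k * g⁻¹)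
    exact ⟨X, hX, key X hX g k hgk⟩

variable {A} in
theorem IsTransitiveOnRel.twoEquiv_aut {Γ : Subgroup (Equiv.Perm G)}
    (h : A.IsTransitiveOnRel Γ) (hle : Γ ≤ A.aut) : TwoEquiv Γ A.aut :=
  (h.cayleyRel_image_eq_orb2 hle).symm.trans ((h.mono hle).cayleyRel_image_eq_orb2 le_rfl)

/-- Any group whose 2-orbits are the basic relations lies in `A.aut`, so `A.aut` inherits its
transitivity. -/
theorem isSchurian_iff : A.IsSchurian ↔ A.IsTransitiveOnRel A.aut := by
  constructor
  · rintro ⟨Γ, hΓ⟩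
    have hrel : ∀ X ∈ A.basicSets, ∃ p : G × G,
        cayleyRel X = {q | ∃ γ ∈ Γ, q = (γ p.1, γ p.2)} := by
      intro X hX
      have : cayleyRel X ∈ orb2 Γ := hΓ ▸ ⟨X, hX, rfl⟩
      exact this
    have hle : Γ ≤ A.aut := by
      intro γ hγ
      refine A.mem_aut_of_forall fun X hX g h hgh => ?_
      obtain ⟨p, hp⟩ := hrel X hX
      rw [← mem_cayleyRel, hp] at hgh ⊢
      obtain ⟨α, hα, he⟩ := hgh
      obtain ⟨rfl, rfl⟩ := Prod.mk.inj he
      exact ⟨γ * α, Γ.mul_mem hγ hα, rfl⟩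
    intro X hX g h g' h' h1 h2
    obtain ⟨p, hp⟩ := hrel X hX
    rw [← mem_cayleyRel, hp] at h1 h2
    obtain ⟨α, hα, he⟩ := h1
    obtain ⟨rfl, rfl⟩ := Prod.mk.inj he
    obtain ⟨β, hβ, he⟩ := h2
    obtain ⟨rfl, rfl⟩ := Prod.mk.inj he
    exact ⟨β * α⁻¹, hle (Γ.mul_mem hβ (Γ.inv_mem hα)), by simp, by simp⟩
  · intro h
    exact ⟨A.aut, h.cayleyRel_image_eq_orb2 le_rfl⟩

variable {A} in
-- Being an automorphism is a condition on pairs of points, and on each pair `δ` agrees with some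
-- automorphism.
theorem le_aut_of_twoEquiv {Δ : Subgroup (Equiv.Perm G)} (h : TwoEquiv Δ A.aut) : Δ ≤ A.aut := by
  intro δ hδ
  refine A.mem_aut_of_forall fun X hX g k hgk => ?_
  obtain ⟨σ, hσ, hg, hk⟩ := h.exists_apply_eq hδ g k
  rw [← hg, ← hk]
  exact apply_mul_inv_mem hσ hX hgk

variable {A} in
theorem IsTransitiveOnRel.of_twoEquiv {Γ Γ' : Subgroup (Equiv.Perm G)}
    (h : A.IsTransitiveOnRel Γ) (h2 : TwoEquiv Γ Γ') : A.IsTransitiveOnRel Γ' := by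
  intro X hX g k g' k' h1 h1'
  obtain ⟨γ, hγ, rfl, rfl⟩ := h X hX g k g' k' h1 h1'
  exact h2.exists_apply_eq hγ g k

variable {U : Subgroup G} (hU : A.IsASubgroup U)

theorem preimage_mem_restrict_basicSets {X : Set G} (hX : X ∈ A.basicSets) {x : G} (hx : x ∈ X)
    (hxU : x ∈ U) : (Subtype.val ⁻¹' X : Set U) ∈ (A.restrict U hU).basicSets := by
  change Subtype.val '' _ ∈ A.basicSets
  rwa [A.image_preimage_eq_of_isASubgroup hU hX hx hxU]

theorem inducedSub_aut_le : inducedSub A.aut U ≤ (A.restrict U hU).aut := by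
  rintro τ ⟨γ, hγ, h⟩
  refine mem_aut_of_forall _ fun Y hY g k hgk => ?_
  have := apply_mul_inv_mem hγ (X := Subtype.val '' Y) hY (g := g) (h := k) ⟨_, hgk, rfl⟩
  rw [← h, ← h] at this
  obtain ⟨u, hu, he⟩ := this
  rwa [← show u = τ k * (τ g)⁻¹ from Subtype.ext he]

end Group

section CommGroup

variable {G : Type*} [CommGroup G] [Finite G] {A : SRing G} {U L : Subgroup G}

/-- The quotients of two points before and after `σ` lie in the same basic set, and `H` is a union
of basic sets. -/
theorem IsASubgroup.preservesCosets {H : Subgroup G} (hH : A.IsASubgroup H) {σ : Equiv.Perm G}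
    (hσ : σ ∈ A.aut) : PreservesCosets H σ := by
  intro x y
  obtain ⟨X, hX, hxy⟩ := A.exists_mem_basicSets (y * x⁻¹)
  have h := apply_mul_inv_mem hσ hX hxy
  rw [mul_comm _ (σ y), mul_comm _ y]
  exact ⟨hH.mem_of_mem hX h hxy, hH.mem_of_mem hX hxy h⟩

theorem inducedOn_aut_le (hL : A.IsASubgroup L) :
    inducedOn A.aut ((↑) : G → G ⧸ L) ≤ (A.quotient L hL).aut := by
  rintro τ ⟨γ, hγ, h⟩
  refine mem_aut_of_forall _ ?_
  rintro _ ⟨X, hX, rfl⟩ g k hgk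
  obtain ⟨g, rfl⟩ := QuotientGroup.mk_surjective g
  obtain ⟨x, hx, hxg⟩ := hgk
  -- The representative `x * g` is chosen so that the relation already holds in `G`, not only modulo
  -- `L`.
  have hk : k = ((x * g : G) : G ⧸ L) := by
    rw [QuotientGroup.mk_mul, hxg]; simp
  rw [hk, h, h]
  exact ⟨_, apply_mul_inv_mem hγ hX (g := g) (h := x * g) (by simpa using hx), by simp⟩

theorem exists_mem_inducedOn_aut (hL : A.IsASubgroup L) {γ : Equiv.Perm G} (hγ : γ ∈ A.aut) :
    ∃ τ ∈ inducedOn A.aut ((↑) : G → G ⧸ L), ∀ g : G, τ (g : G ⧸ L) = (γ g : G ⧸ L) := by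
  have hp := hL.preservesCosets hγ
  let e : Equiv.Perm (G ⧸ L) := Quotient.congr (ra := QuotientGroup.leftRel L)
    (rb := QuotientGroup.leftRel L) γ fun a b => by
      rw [QuotientGroup.leftRel_apply, QuotientGroup.leftRel_apply]
      exact (hp a b).symm
  exact ⟨e, ⟨γ, hγ, fun g => rfl⟩, fun g => rfl⟩

end CommGroup

end SRing

/-! ### Construction of elements of the canonical generalized wreath product. -/

section Wreath

variable {G : Type*} [CommGroup G] {U L : Subgroup G} {ΔU : Subgroup (Equiv.Perm U)}
  {Δ0 : Subgroup (Equiv.Perm (G ⧸ L))}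

theorem mk_mem_map_mk_iff (hLU : L ≤ U) (g : G) :
    (g : G ⧸ L) ∈ U.map (QuotientGroup.mk' L) ↔ g ∈ U := by
  constructor
  · rintro ⟨u, hu, he⟩
    have : u⁻¹ * g ∈ L := QuotientGroup.eq.1 he
    exact (U.mul_mem_cancel_left (U.inv_mem hu)).1 (hLU this)
  · intro hg
    exact ⟨g, hg, rfl⟩

/-- The pointwise formula alone forces both translations to match the cosets: `c * a` lies in `U`,
and `δ` is onto `U`. -/
theorem restrictsToDelta_of_forall {γ : Equiv.Perm G} {c a b : G} {δ : Equiv.Perm U}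
    (hδ : δ ∈ ΔU) (h : ∀ x ∈ c • (U : Set G), ∃ hx : x * a ∈ U, γ x = δ ⟨x * a, hx⟩ * b) :
    RestrictsToDelta ΔU (c • (U : Set G)) (γ '' (c • (U : Set G))) γ := by
  have hca : c * a ∈ U := (h c (by simp [mem_leftCoset_iff])).1
  have hmem : ∀ u : U, (u : G) * a⁻¹ ∈ c • (U : Set G) := by
    intro u
    rw [mem_leftCoset_iff]
    have : c⁻¹ * (u * a⁻¹) = u * (c * a)⁻¹ := by
      rw [mul_inv]
      ac_rfl
    rw [this]
    exact U.mul_mem u.2 (U.inv_mem hca)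
  refine ⟨a, b, δ, hδ, ?_, ?_, h⟩
  · ext y
    constructor
    · rintro ⟨x, hx, rfl⟩
      exact (h x hx).1
    · intro hy
      exact ⟨y * a⁻¹, hmem ⟨y, hy⟩, by simp⟩
  · ext y
    constructor
    · rintro ⟨u, hu, rfl⟩
      refine ⟨_, hmem (δ⁻¹ ⟨u, hu⟩), ?_⟩
      obtain ⟨_, h2⟩ := h _ (hmem (δ⁻¹ ⟨u, hu⟩))
      rw [h2]
      simp
    · rintro ⟨x, hx, rfl⟩
      obtain ⟨hxa, h2⟩ := h x hx
      exact ⟨_, (δ ⟨x * a, hxa⟩).2, h2.symm⟩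

/-- On the coset `q` of `U`, the map `ψ` is a composition of a translation to `U`, an element
of `ΔU` and a translation, and it induces the restriction of `δ0`. -/
def IsLocalLift (ΔU : Subgroup (Equiv.Perm U)) (δ0 : Equiv.Perm (G ⧸ L)) (q : G ⧸ U)
    (ψ : G → G) : Prop :=
  ∃ a b : G, ∃ δ ∈ ΔU, ∀ x : G, (x : G ⧸ U) = q →
    (∃ hx : x * a ∈ U, ψ x = δ ⟨x * a, hx⟩ * b) ∧ (ψ x : G ⧸ L) = δ0 (x : G ⧸ L)

theorem exists_isLocalLift_of_forall {δ : Equiv.Perm U} (hδ : δ ∈ ΔU) {δ0 : Equiv.Perm (G ⧸ L)}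
    {c b : G} (h : ∀ u : U, ((δ u * b : G) : G ⧸ L) = δ0 ((u * c : G) : G ⧸ L)) :
    ∃ ψ, IsLocalLift ΔU δ0 (c : G ⧸ U) ψ ∧ ∀ u : U, ψ (u * c) = δ u * b := by
  classical
  -- The value `1` off the coset of `c` is irrelevant, since `IsLocalLift` only looks at that coset.
  let ψ : G → G := fun x => if hx : x * c⁻¹ ∈ U then δ ⟨x * c⁻¹, hx⟩ * b else 1
  refine ⟨ψ, ⟨c⁻¹, b, δ, hδ, fun x hx => ?_⟩, fun u => ?_⟩
  · have hxc : x * c⁻¹ ∈ U := by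
      rw [mul_comm]
      exact QuotientGroup.eq.1 hx.symm
    have hψ : ψ x = δ ⟨x * c⁻¹, hxc⟩ * b := dif_pos hxc
    refine ⟨⟨hxc, hψ⟩, ?_⟩
    rw [hψ, h]
    simp
  · have huc : (u : G) * c * c⁻¹ ∈ U := by simp
    have he : (⟨(u : G) * c * c⁻¹, huc⟩ : U) = u := Subtype.ext (by simp)
    exact (dif_pos huc).trans (by rw [he])

variable (hc : IsCompatible U L ΔU Δ0)
include hc

/-- This is where equality of the induced groups enters: `δ0`, translated so as to stabilize `U/L`,
induces there an element that comes from `ΔU`. -/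
theorem IsCompatible.exists_isLocalLift_apply_eq {δ0 : Equiv.Perm (G ⧸ L)} (hδ0 : δ0 ∈ Δ0)
    {c y : G} (hy : (y : G ⧸ L) = δ0 (c : G ⧸ L)) :
    ∃ ψ, IsLocalLift ΔU δ0 (c : G ⧸ U) ψ ∧ ψ c = y := by
  obtain ⟨τ, hτ, h1⟩ := exists_mem_inducedSub hc.rightRegular_le_0 hc.invariant_0 hδ0
    (c := (c : G ⧸ L)) (y := (y : G ⧸ L)) (by rw [hy]; simp)
  rw [← hc.induced_eq] at hτ
  obtain ⟨δ, hδ, h2⟩ := hτ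
  have h3 : ∀ u : U, ((δ u : G) : G ⧸ L) * y = δ0 ((u * c : G) : G ⧸ L) := by
    intro u
    have h4 := congrArg Subtype.val (h2 u)
    change _ = ((δ u : G) : G ⧸ L) at h4
    rw [← h4, h1]
    rfl
  have h5 : ((δ 1 : G) : G ⧸ L) = 1 := by
    have := h3 1
    rw [OneMemClass.coe_one, one_mul, ← hy] at this
    simpa using this
  -- Since `δ 1` lies in `L`, replacing `y` by `(δ 1)⁻¹ * y` changes nothing modulo `L`, and it
  -- sends `c` exactly to `y`.
  obtain ⟨ψ, hψ, h6⟩ := exists_isLocalLift_of_forall hδ (δ0 := δ0) (c := c) (b := (δ 1 : G)⁻¹ * y)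
    (by
      intro u
      rw [← h3, QuotientGroup.mk_mul, QuotientGroup.mk_mul, QuotientGroup.mk_inv, h5]
      simp)
  refine ⟨ψ, hψ, ?_⟩
  have := h6 1
  simpa using this

/-- Points with equal images lie in one `L`-coset because `δ0` is injective, hence in one `U`-coset,
where the local lift is injective. Finiteness then gives a permutation. -/
theorem IsCompatible.exists_mem_of_isLocalLift [Finite G] (hLU : L ≤ U)
    {δ0 : Equiv.Perm (G ⧸ L)} (hδ0 : δ0 ∈ Δ0) {ψ : G ⧸ U → G → G}
    (hψ : ∀ q, IsLocalLift ΔU δ0 q (ψ q)) :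
    ∃ γ ∈ canonicalGenWreath hc, ∀ x : G, γ x = ψ x x := by
  have hmk : ∀ x : G, ((ψ x x : G) : G ⧸ L) = δ0 (x : G ⧸ L) := by
    intro x
    obtain ⟨a, b, δ, hδ, h⟩ := hψ x
    exact (h x rfl).2
  have hinj : Function.Injective fun x : G => ψ x x := by
    intro x y hxy
    change ψ x x = ψ y y at hxy
    have h1 : (x : G ⧸ L) = (y : G ⧸ L) := δ0.injective (by rw [← hmk, ← hmk, hxy])
    have h2 : (x : G ⧸ U) = (y : G ⧸ U) := QuotientGroup.eq.2 (hLU (QuotientGroup.eq.1 h1))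
    obtain ⟨a, b, δ, hδ, h⟩ := hψ x
    obtain ⟨⟨hx, hx'⟩, -⟩ := h x rfl
    obtain ⟨⟨hy, hy'⟩, -⟩ := h y h2.symm
    rw [← h2, hx', hy'] at hxy
    simpa using hxy
  let γ : Equiv.Perm G := Equiv.ofBijective _ (Finite.injective_iff_bijective.1 hinj)
  have hγ : ∀ x : G, γ x = ψ x x := fun x => rfl
  have hγ0 : ∀ x : G, ((γ x : G) : G ⧸ L) = δ0 (x : G ⧸ L) := hmk
  refine ⟨γ, ⟨fun x y => ?_, fun x y => ?_, ⟨δ0, hδ0, fun g => (hγ0 g).symm⟩, fun c => ?_⟩, hγ⟩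
  · rw [← QuotientGroup.eq, ← QuotientGroup.eq, hγ0, hγ0, δ0.injective.eq_iff]
  · have := hc.invariant_0 δ0 hδ0 (x : G ⧸ L) (y : G ⧸ L)
    rwa [← hγ0, ← hγ0, ← QuotientGroup.mk_inv, ← QuotientGroup.mk_mul, ← QuotientGroup.mk_inv,
      ← QuotientGroup.mk_mul, mk_mem_map_mk_iff hLU, mk_mem_map_mk_iff hLU] at this
  · obtain ⟨a, b, δ, hδ, h⟩ := hψ c
    refine restrictsToDelta_of_forall (a := a) (b := b) hδ fun x hx => ?_
    have hxc : (x : G ⧸ U) = (c : G ⧸ U) := by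
      rw [mem_leftCoset_iff] at hx
      exact (QuotientGroup.eq.2 hx).symm
    rw [hγ, hxc]
    exact (h x hxc).1

theorem IsCompatible.exists_isLocalLift {δ0 : Equiv.Perm (G ⧸ L)} (hδ0 : δ0 ∈ Δ0)
    (q : G ⧸ U) : ∃ ψ, IsLocalLift ΔU δ0 q ψ := by
  obtain ⟨c, rfl⟩ := QuotientGroup.mk_surjective q
  obtain ⟨y, hy⟩ := QuotientGroup.mk_surjective (δ0 (c : G ⧸ L))
  obtain ⟨ψ, hψ, -⟩ := hc.exists_isLocalLift_apply_eq hδ0 hy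
  exact ⟨ψ, hψ⟩

/-- Up to translations, every element of `ΔU` extends to the canonical generalized wreath
product. -/
theorem IsCompatible.exists_mem_extending [Finite G] (hLU : L ≤ U) {δ : Equiv.Perm U}
    (hδ : δ ∈ ΔU) (g g' : G) :
    ∃ γ ∈ canonicalGenWreath hc, ∀ u : U, γ (u * g) = δ u * g' := by
  classical
  -- As `δ` respects `L`-cosets in `U`, it descends to `U/L`; the descent is computed through a
  -- section `s`.
  have hind : ∃ τ ∈ inducedOn ΔU ((QuotientGroup.mk' L).subgroupMap U),
      ∀ u, τ ((QuotientGroup.mk' L).subgroupMap U u) = (QuotientGroup.mk' L).subgroupMap U (δ u) := by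
    have hq : ∀ x y : U, (QuotientGroup.mk' L).subgroupMap U x =
        (QuotientGroup.mk' L).subgroupMap U y ↔ x⁻¹ * y ∈ L.subgroupOf U := by
      intro x y
      rw [Subtype.ext_iff, Subgroup.mem_subgroupOf]
      exact QuotientGroup.eq
    have hf : ∀ x y : U, (QuotientGroup.mk' L).subgroupMap U x =
        (QuotientGroup.mk' L).subgroupMap U y ↔ (QuotientGroup.mk' L).subgroupMap U (δ x) =
        (QuotientGroup.mk' L).subgroupMap U (δ y) := by
      intro x y
      rw [hq, hq]
      exact (hc.invariant_U δ hδ x y).symm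
    have hs := (QuotientGroup.mk' L).subgroupMap_surjective U
    let s := Function.surjInv hs
    have hs' : ∀ v, (QuotientGroup.mk' L).subgroupMap U (s v) = v := Function.surjInv_eq hs
    have hap : ∀ u, (QuotientGroup.mk' L).subgroupMap U
        (δ (s ((QuotientGroup.mk' L).subgroupMap U u))) =
        (QuotientGroup.mk' L).subgroupMap U (δ u) := by
      intro u
      rw [← hf, hs']
    have hbij : Function.Bijective fun v => (QuotientGroup.mk' L).subgroupMap U (δ (s v)) := by
      constructor
      · intro v w hvw
        have := (hf _ _).2 hvw
        rwa [hs', hs'] at this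
      · intro v
        refine ⟨(QuotientGroup.mk' L).subgroupMap U (δ⁻¹ (s v)), ?_⟩
        change (QuotientGroup.mk' L).subgroupMap U _ = v
        rw [hap, Equiv.Perm.inv_def, Equiv.apply_symm_apply, hs']
    exact ⟨Equiv.ofBijective _ hbij, ⟨δ, hδ, hap⟩, hap⟩
  obtain ⟨τ, hτ, hτδ⟩ := hind
  rw [hc.induced_eq] at hτ
  obtain ⟨α, hα, hατ⟩ := hτ
  -- `α` extends `τ` to `G/L`; the translations make `δ0` agree on the coset of `g` with what `u * g
  -- ↦ δ u * g'` induces.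
  let δ0 : Equiv.Perm (G ⧸ L) :=
    Equiv.mulRight (g' : G ⧸ L) * α * Equiv.mulRight (g : G ⧸ L)⁻¹
  have hδ0 : δ0 ∈ Δ0 := Δ0.mul_mem
    (Δ0.mul_mem (mulRight_mem_of_rightRegular_le hc.rightRegular_le_0 _) hα)
    (mulRight_mem_of_rightRegular_le hc.rightRegular_le_0 _)
  have h0 : ∀ u : U, ((δ u * g' : G) : G ⧸ L) = δ0 ((u * g : G) : G ⧸ L) := by
    intro u
    have h1 := congrArg Subtype.val (hτδ u)
    rw [hατ] at h1
    change α ((u : G) : G ⧸ L) = ((δ u : G) : G ⧸ L) at h1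
    simp [δ0, h1]
  obtain ⟨ψ, hψ, hψδ⟩ := exists_isLocalLift_of_forall hδ h0
  -- The prescribed lift is used on the coset of `g`, an arbitrary one elsewhere.
  have hex : ∀ q : G ⧸ U, ∃ φ, IsLocalLift ΔU δ0 q φ ∧ (q = g → φ = ψ) := by
    intro q
    by_cases hq : q = g
    · subst hq
      exact ⟨ψ, hψ, fun _ => rfl⟩
    · obtain ⟨φ, hφ⟩ := hc.exists_isLocalLift hδ0 q
      exact ⟨φ, hφ, fun h => absurd h hq⟩
  choose φ hφ hφg using hex
  obtain ⟨γ, hγ, hγφ⟩ := hc.exists_mem_of_isLocalLift hLU hδ0 hφ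
  refine ⟨γ, hγ, fun u => ?_⟩
  rw [hγφ, hφg _ _, hψδ]
  refine (QuotientGroup.eq.2 ?_).symm
  rw [mul_comm (u : G), inv_mul_cancel_left]
  exact u.2

/-- Every element of `Δ0` lifts to the canonical generalized wreath product, and the images of two
points in distinct `U`-cosets can be prescribed within the `L`-cosets that contain them. -/
theorem IsCompatible.exists_mem_lifting [Finite G] (hLU : L ≤ U) {δ0 : Equiv.Perm (G ⧸ L)}
    (hδ0 : δ0 ∈ Δ0) {g h g' h' : G} (hgh : h * g⁻¹ ∉ U) (hg : (g' : G ⧸ L) = δ0 (g : G ⧸ L))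
    (hh : (h' : G ⧸ L) = δ0 (h : G ⧸ L)) :
    ∃ γ ∈ canonicalGenWreath hc, γ g = g' ∧ γ h = h' := by
  have hne : (g : G ⧸ U) ≠ (h : G ⧸ U) := by
    rwa [Ne, QuotientGroup.eq, mul_comm]
  have hex : ∀ q : G ⧸ U, ∃ φ, IsLocalLift ΔU δ0 q φ ∧ (q = g → φ g = g') ∧
      (q = h → φ h = h') := by
    intro q
    by_cases hq : q = g
    · subst hq
      obtain ⟨φ, hφ, h1⟩ := hc.exists_isLocalLift_apply_eq hδ0 hg
      exact ⟨φ, hφ, fun _ => h1, fun h2 => absurd h2 hne⟩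
    · by_cases hq' : q = h
      · subst hq'
        obtain ⟨φ, hφ, h1⟩ := hc.exists_isLocalLift_apply_eq hδ0 hh
        exact ⟨φ, hφ, fun h2 => absurd h2 hq, fun _ => h1⟩
      · obtain ⟨φ, hφ⟩ := hc.exists_isLocalLift hδ0 q
        exact ⟨φ, hφ, fun h2 => absurd h2 hq, fun h2 => absurd h2 hq'⟩
  choose φ hφ hφg hφh using hex
  obtain ⟨γ, hγ, hγφ⟩ := hc.exists_mem_of_isLocalLift hLU hδ0 hφ
  exact ⟨γ, hγ, by rw [hγφ, hφg _ rfl], by rw [hγφ, hφh _ rfl]⟩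

end Wreath

/-! ### Generalized wreath products of S-rings. -/

namespace SRing

namespace IsGenWreath

variable {G : Type*} [CommGroup G] [Finite G] {A : SRing G} {U L : Subgroup G}
  (hA : A.IsGenWreath U L)
include hA

theorem isCompatible :
    IsCompatible U L (inducedSub A.aut U) (inducedOn A.aut ((↑) : G → G ⧸ L)) where
  rightRegular_le_U := by
    rintro σ ⟨a, ha⟩
    exact ⟨Equiv.mulRight (a : G), mulRight_mem_of_rightRegular_le A.rightRegular_le_aut _,
      fun u => by simp [ha]⟩
  rightRegular_le_0 := by
    rintro σ ⟨a, ha⟩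
    obtain ⟨a, rfl⟩ := QuotientGroup.mk_surjective a
    exact ⟨Equiv.mulRight a, mulRight_mem_of_rightRegular_le A.rightRegular_le_aut _,
      fun u => by simp [ha]⟩
  invariant_U := by
    rintro δ ⟨γ, hγ, h⟩ x y
    have := hA.isASubgroup_L.preservesCosets hγ x y
    rw [← h, ← h] at this
    simpa [Subgroup.mem_subgroupOf] using this
  invariant_0 := by
    rintro δ ⟨γ, hγ, h⟩ x y
    obtain ⟨x, rfl⟩ := QuotientGroup.mk_surjective x
    obtain ⟨y, rfl⟩ := QuotientGroup.mk_surjective y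
    rw [h, h, ← QuotientGroup.mk_inv, ← QuotientGroup.mk_mul, ← QuotientGroup.mk_inv,
      ← QuotientGroup.mk_mul, mk_mem_map_mk_iff hA.le, mk_mem_map_mk_iff hA.le]
    exact hA.isASubgroup_U.preservesCosets hγ x y
  induced_eq := by
    ext τ
    constructor
    · rintro ⟨δ, ⟨γ, hγ, hγδ⟩, h⟩
      obtain ⟨σ, hσ, hσγ⟩ := exists_mem_inducedOn_aut hA.isASubgroup_L hγ
      refine ⟨σ, hσ, fun v => ?_⟩
      obtain ⟨u, rfl⟩ := (QuotientGroup.mk' L).subgroupMap_surjective U v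
      rw [h]
      change ((δ u : G) : G ⧸ L) = σ ((u : G) : G ⧸ L)
      rw [hσγ, hγδ]
    · rintro ⟨σ, ⟨γ, hγ, hσγ⟩, h⟩
      have hmem : ∀ u : U, ((γ u : G) : G ⧸ L) =
          τ ((QuotientGroup.mk' L).subgroupMap U u) := fun u => by
        rw [h, ← hσγ]
        rfl
      -- Stabilizing `U/L` in the quotient amounts to stabilizing `U`, because `L ≤ U`; so `γ`
      -- restricts to `U`.
      have h1 : γ 1 ∈ U := by
        rw [← mk_mem_map_mk_iff hA.le]
        have := hmem 1
        rw [OneMemClass.coe_one] at this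
        rw [this]
        exact (τ _).2
      have hs := (hA.isASubgroup_U.preservesCosets hγ).apply_mem_iff U.one_mem h1
      exact ⟨Equiv.Perm.subtypePerm γ hs, ⟨γ, hγ, fun u => rfl⟩,
        fun u => Subtype.ext (hmem u).symm⟩

/-- Inside a `U`-coset the translations cancel in the quotient of two images, leaving an
automorphism of `A_U`. Across cosets the action on `G/L` decides everything. -/
theorem canonicalGenWreath_le_aut {ΔU : Subgroup (Equiv.Perm U)}
    {Δ0 : Subgroup (Equiv.Perm (G ⧸ L))} (hc : IsCompatible U L ΔU Δ0)
    (hΔU : ΔU ≤ (A.restrict U hA.isASubgroup_U).aut)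
    (hΔ0 : Δ0 ≤ (A.quotient L hA.isASubgroup_L).aut) : canonicalGenWreath hc ≤ A.aut := by
  rintro γ ⟨-, -, ⟨δ0, hδ0, h0⟩, hγ⟩
  refine A.mem_aut_of_forall fun X hX g h hgh => ?_
  by_cases hU : h * g⁻¹ ∈ U
  · obtain ⟨a, b, δ, hδ, -, -, h1⟩ := hγ g
    obtain ⟨hga, hg⟩ := h1 g (by simp [mem_leftCoset_iff])
    obtain ⟨hha, hh⟩ := h1 h (by rwa [mem_leftCoset_iff, mul_comm])
    have := apply_mul_inv_mem (hΔU hδ)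
      (A.preimage_mem_restrict_basicSets hA.isASubgroup_U hX hgh hU)
      (g := ⟨g * a, hga⟩) (h := ⟨h * a, hha⟩) (by simpa using hgh)
    rw [hg, hh]
    simpa using this
  · have hXU : X ⊆ (U : Set G)ᶜ := fun x hx hxU =>
      hU (hA.isASubgroup_U.mem_of_mem hX hx hgh hxU)
    have hq : ((h : G ⧸ L) * (g : G ⧸ L)⁻¹) ∈ ((↑) '' X : Set (G ⧸ L)) := ⟨_, hgh, by simp⟩
    have := apply_mul_inv_mem (hΔ0 hδ0) ⟨X, hX, rfl⟩ hq
    rw [h0, h0] at this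
    obtain ⟨x, hx, he⟩ := this
    -- Membership is known only modulo `L`; the identity `L * X = X` upgrades it to membership in
    -- `X`.
    rw [← hA.mul_eq X hX hXU]
    refine Set.mem_mul.2 ⟨x⁻¹ * (γ h * (γ g)⁻¹), QuotientGroup.eq.1 ?_, x, hx, ?_⟩
    · simpa using he
    · rw [mul_comm, mul_inv_cancel_left]

theorem exists_mem_inducedSub_aut {γ : Equiv.Perm G} (hγ : γ ∈ A.aut) {c y : G}
    (hy : γ c * y⁻¹ ∈ U) :
    ∃ τ ∈ inducedSub A.aut U, ∀ u : U, (τ u : G) * y = γ (u * c) :=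
  exists_mem_inducedSub A.rightRegular_le_aut
    (fun _ h => hA.isASubgroup_U.preservesCosets h) hγ hy

theorem aut_eq_canonicalGenWreath : A.aut = canonicalGenWreath hA.isCompatible := by
  refine le_antisymm (fun γ hγ => ?_) (hA.canonicalGenWreath_le_aut _
    (A.inducedSub_aut_le hA.isASubgroup_U) (inducedOn_aut_le hA.isASubgroup_L))
  refine ⟨hA.isASubgroup_L.preservesCosets hγ, hA.isASubgroup_U.preservesCosets hγ,
    exists_mem_inducedOn_aut hA.isASubgroup_L hγ, fun c => ?_⟩
  obtain ⟨δ, hδ, h⟩ := hA.exists_mem_inducedSub_aut hγ (c := c) (y := γ c) (by simp [U.one_mem])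
  refine restrictsToDelta_of_forall (a := c⁻¹) (b := γ c) hδ fun x hx => ?_
  rw [mem_leftCoset_iff, mul_comm] at hx
  exact ⟨hx, by simp [h]⟩

theorem isTransitiveOnRel_inducedSub (h : A.IsTransitiveOnRel A.aut) :
    (A.restrict U hA.isASubgroup_U).IsTransitiveOnRel (inducedSub A.aut U) := by
  intro Y hY g k g' k' h1 h2
  obtain ⟨γ, hγ, hg, hk⟩ := h _ hY g k g' k' ⟨_, h1, rfl⟩ ⟨_, h2, rfl⟩
  -- An automorphism carrying one point of `U` into `U` stabilizes `U`.
  obtain ⟨τ, hτ, hτγ⟩ := hA.exists_mem_inducedSub_aut hγ (c := 1) (y := 1) (by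
    have := (hA.isASubgroup_U.preservesCosets hγ).apply_mem_iff g.2 (hg ▸ g'.2) 1
    simpa [U.one_mem] using this)
  refine ⟨τ, hτ, Subtype.ext ?_, Subtype.ext ?_⟩
  · simpa [hg] using hτγ g
  · simpa [hk] using hτγ k

theorem isTransitiveOnRel_inducedOn (h : A.IsTransitiveOnRel A.aut) :
    (A.quotient L hA.isASubgroup_L).IsTransitiveOnRel
      (inducedOn A.aut ((↑) : G → G ⧸ L)) := by
  rintro _ ⟨X, hX, rfl⟩ g k g' k' ⟨x, hx, h1⟩ ⟨x', hx', h2⟩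
  obtain ⟨g, rfl⟩ := QuotientGroup.mk_surjective g
  obtain ⟨g', rfl⟩ := QuotientGroup.mk_surjective g'
  obtain ⟨γ, hγ, hg, hk⟩ := h X hX g (x * g) g' (x' * g') (by simpa using hx)
    (by simpa using hx')
  obtain ⟨τ, hτ, hτγ⟩ := exists_mem_inducedOn_aut hA.isASubgroup_L hγ
  obtain rfl := eq_mul_inv_iff_mul_eq.1 h1
  obtain rfl := eq_mul_inv_iff_mul_eq.1 h2
  refine ⟨τ, hτ, by rw [hτγ, hg], ?_⟩
  rw [← QuotientGroup.mk_mul, hτγ, hk, QuotientGroup.mk_mul]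

section Compatible

variable {ΔU : Subgroup (Equiv.Perm U)} {Δ0 : Subgroup (Equiv.Perm (G ⧸ L))}
  (hc : IsCompatible U L ΔU Δ0)

/-- No schurity is needed: each automorphism is imitated on each pair of points separately. -/
theorem twoEquiv_aut_canonicalGenWreath
    (hΔU : TwoEquiv ΔU (A.restrict U hA.isASubgroup_U).aut)
    (hΔ0 : TwoEquiv Δ0 (A.quotient L hA.isASubgroup_L).aut) :
    TwoEquiv A.aut (canonicalGenWreath hc) := by
  refine twoEquiv_of_le (hA.canonicalGenWreath_le_aut hc (le_aut_of_twoEquiv hΔU)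
    (le_aut_of_twoEquiv hΔ0)) fun σ hσ g h => ?_
  by_cases hU : h * g⁻¹ ∈ U
  · obtain ⟨τ, hτ, hτσ⟩ := hA.exists_mem_inducedSub_aut hσ (c := g) (y := σ g)
      (by simp [U.one_mem])
    -- Translated to `U`, the pair `(g, h)` becomes `(1, h * g⁻¹)`; agreement of `δ` and `τ` on
    -- these two points is enough.
    obtain ⟨δ, hδ, hδ1, hδ2⟩ := TwoEquiv.exists_apply_eq (Eq.symm hΔU)
      (A.inducedSub_aut_le hA.isASubgroup_U hτ) 1 ⟨h * g⁻¹, hU⟩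
    obtain ⟨γ, hγ, hγδ⟩ := hc.exists_mem_extending hA.le hδ g (σ g)
    refine ⟨γ, hγ, ?_, ?_⟩
    · have := hγδ 1
      rw [hδ1, hτσ] at this
      simpa using this
    · have := hγδ ⟨h * g⁻¹, hU⟩
      rw [hδ2, hτσ] at this
      simpa using this
  · obtain ⟨τ, hτ, hτσ⟩ := exists_mem_inducedOn_aut hA.isASubgroup_L hσ
    obtain ⟨δ, hδ, hδg, hδh⟩ := TwoEquiv.exists_apply_eq (Eq.symm hΔ0)
      (inducedOn_aut_le hA.isASubgroup_L hτ) g h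
    exact hc.exists_mem_lifting hA.le hδ hU (by rw [hδg, hτσ]) (by rw [hδh, hτσ])

/-- The source and target pairs are of the same kind, since `U` is a union of basic sets. Across
cosets, transitivity on `G/L` suffices, as points can be adjusted within `L`-cosets. -/
theorem isTransitiveOnRel_canonicalGenWreath
    (hΔU : (A.restrict U hA.isASubgroup_U).IsTransitiveOnRel ΔU)
    (hΔ0 : (A.quotient L hA.isASubgroup_L).IsTransitiveOnRel Δ0) :
    A.IsTransitiveOnRel (canonicalGenWreath hc) := by
  intro X hX g h g' h' h1 h2
  by_cases hU : h * g⁻¹ ∈ U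
  · have hU' : h' * g'⁻¹ ∈ U := hA.isASubgroup_U.mem_of_mem hX h1 h2 hU
    obtain ⟨δ, hδ, hδ1, hδ2⟩ := hΔU _
      (A.preimage_mem_restrict_basicSets hA.isASubgroup_U hX h1 hU) 1 ⟨h * g⁻¹, hU⟩ 1
      ⟨h' * g'⁻¹, hU'⟩ (by simpa using h1) (by simpa using h2)
    obtain ⟨γ, hγ, hγδ⟩ := hc.exists_mem_extending hA.le hδ g g'
    refine ⟨γ, hγ, ?_, ?_⟩
    · simpa [hδ1] using hγδ 1
    · simpa [hδ2] using hγδ ⟨h * g⁻¹, hU⟩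
  · obtain ⟨δ, hδ, hδg, hδh⟩ := hΔ0 _ ⟨X, hX, rfl⟩ g h g' h' ⟨_, h1, by simp⟩
      ⟨_, h2, by simp⟩
    exact hc.exists_mem_lifting hA.le hδ hU hδg.symm hδh.symm

end Compatible

end IsGenWreath

end SRing

end SchurRing

theorem theorem1p2 {G : Type*} [CommGroup G] [Finite G] (A : SchurRing.SRing G)
    (U L : Subgroup G) (hA : A.IsGenWreath U L) :
    -- `Aut(A) = Aut(A)^U ≀_{U/L} Aut(A)^{G/L}`
    (∃ h : SchurRing.IsCompatible U L (SchurRing.inducedSub A.aut U)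
        (SchurRing.inducedOn A.aut ((↑) : G → G ⧸ L)),
      A.aut = SchurRing.canonicalGenWreath h) ∧
    -- the criterion for schurity
    (A.IsSchurian ↔
      (A.restrict U hA.isASubgroup_U).IsSchurian ∧ (A.quotient L hA.isASubgroup_L).IsSchurian ∧
      ∃ (ΔU : Subgroup (Equiv.Perm U)) (Δ0 : Subgroup (Equiv.Perm (G ⧸ L))),
        SchurRing.IsCompatible U L ΔU Δ0 ∧
        SchurRing.TwoEquiv ΔU (A.restrict U hA.isASubgroup_U).aut ∧
        SchurRing.TwoEquiv Δ0 (A.quotient L hA.isASubgroup_L).aut) ∧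
    -- for all groups as in the criterion
    (∀ (ΔU : Subgroup (Equiv.Perm U)) (Δ0 : Subgroup (Equiv.Perm (G ⧸ L)))
        (h : SchurRing.IsCompatible U L ΔU Δ0),
        SchurRing.TwoEquiv ΔU (A.restrict U hA.isASubgroup_U).aut →
        SchurRing.TwoEquiv Δ0 (A.quotient L hA.isASubgroup_L).aut →
      ΔU ≤ (A.restrict U hA.isASubgroup_U).aut ∧ Δ0 ≤ (A.quotient L hA.isASubgroup_L).aut ∧
      SchurRing.TwoEquiv A.aut (SchurRing.canonicalGenWreath h)) := by
  refine ⟨⟨hA.isCompatible, hA.aut_eq_canonicalGenWreath⟩, ⟨fun h => ?_, ?_⟩, ?_⟩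
  · rw [SchurRing.SRing.isSchurian_iff] at h
    have h1 := hA.isTransitiveOnRel_inducedSub h
    have h2 := hA.isTransitiveOnRel_inducedOn h
    have h3 := A.inducedSub_aut_le hA.isASubgroup_U
    have h4 := SchurRing.SRing.inducedOn_aut_le hA.isASubgroup_L
    exact ⟨⟨_, h1.cayleyRel_image_eq_orb2 h3⟩, ⟨_, h2.cayleyRel_image_eq_orb2 h4⟩, _, _,
      hA.isCompatible, h1.twoEquiv_aut h3, h2.twoEquiv_aut h4⟩
  · rintro ⟨hU, h0, ΔU, Δ0, hc, hΔU, hΔ0⟩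
    rw [SchurRing.SRing.isSchurian_iff] at hU h0
    exact ⟨_, (hA.isTransitiveOnRel_canonicalGenWreath hc (hU.of_twoEquiv (Eq.symm hΔU))
      (h0.of_twoEquiv (Eq.symm hΔ0))).cayleyRel_image_eq_orb2
      (hA.canonicalGenWreath_le_aut hc (SchurRing.SRing.le_aut_of_twoEquiv hΔU)
        (SchurRing.SRing.le_aut_of_twoEquiv hΔ0))⟩
  · intro ΔU Δ0 hc hΔU hΔ0
    exact ⟨SchurRing.SRing.le_aut_of_twoEquiv hΔU, SchurRing.SRing.le_aut_of_twoEquiv hΔ0,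
      hA.twoEquiv_aut_canonicalGenWreath hc hΔU hΔ0⟩
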